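/- Let $X$ be a geodesic metric space, let $K\ge 1$ and $C\ge 0$, and let $\mathcal H$ be a family of $(K,C)$-quasi-geodesic paths in $X$, that is, of maps $H\colon[0,L_H]\to X$ (not necessarily continuous) with $\frac1K|s-t|-C\le d_X(H(s),H(t))\le K|s-t|+C$ for all $s,t\in[0,L_H]$; the image of such a path is also denoted by $H$. Suppose that $\mathcal H$ has the coarsely contracting property, that is: 1. (transitivity) every pair of points of $X$ is connected by a path in $\mathcal H$, that is, the two points are the endpoints of that path; 2. there are constants $b,c>0$ such that for every $H\in\mathcal H$ there is a map $\widehat\Phi_H\colon X\to H$ that is coarsely the identity on $H$, meaning $d_X(\widehat\Phi_H(x),x)\le c$ for all $x\in H$, and such that for all $\mu,\mu'\in X$ with $d_X(\mu,\mu')<b\cdot d_X(\mu,\widehat\Phi_H(\mu))$ one has $d_X(\widehat\Phi_H(\mu),\widehat\Phi_H(\mu'))<c$. Then $X$ is $\delta$-hyperbolic for some $\delta\ge 0$: for all $x,y,z\in X$ and all choices of geodesics $[x,y]$, $[y,z]$, $[x,z]$, every point of $[x,y]$ is within distance $\delta$ of a point of $[x,z]\cup[y,z]$. -/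

import Mathlib

/-- `S` is (the image of) a geodesic from `x` to `y`, i.e. the image of an isometric embedding of
the interval `[0, dist x y]` sending `0` to `x` and `dist x y` to `y`. -/
def IsGeodesicSegment {X : Type*} [MetricSpace X] (S : Set X) (x y : X) : Prop :=
  ∃ γ : ℝ → X, γ 0 = x ∧ γ (dist x y) = y ∧
    (∀ s ∈ Set.Icc 0 (dist x y), ∀ t ∈ Set.Icc 0 (dist x y), dist (γ s) (γ t) = |s - t|) ∧
    S = γ '' Set.Icc 0 (dist x y)

/-- A metric space in which any two points are joined by a geodesic. -/
def IsGeodesicSpace (X : Type*) [MetricSpace X] : Prop :=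
  ∀ x y : X, ∃ S : Set X, IsGeodesicSegment S x y

/-- The thin triangle condition with constant `δ`: for every triple of points and every choice of
geodesics between them, the side `[a, b]` lies in the `δ`-neighborhood of the union of the two
other sides. -/
def IsDeltaHyperbolic (X : Type*) [MetricSpace X] (δ : ℝ) : Prop :=
  ∀ (a b c : X) (ab bc ac : Set X), IsGeodesicSegment ab a b → IsGeodesicSegment bc b c →
    IsGeodesicSegment ac a c → ∀ p ∈ ab, ∃ q ∈ ac ∪ bc, dist p q ≤ δ

/-- `X` is `δ`-hyperbolic for some constant `δ`. -/
def IsHyperbolicSpace (X : Type*) [MetricSpace X] : Prop :=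
  ∃ δ : ℝ, 0 ≤ δ ∧ IsDeltaHyperbolic X δ

/-- A path in the coarse sense: a map from a compact interval `[0, len]` to `X`. Continuity is not
required, so ordinary continuous paths are a special case. -/
structure CoarsePath (X : Type*) where
  len : ℝ
  len_nonneg : 0 ≤ len
  toFun : Set.Icc (0 : ℝ) len → X

namespace CoarsePath

/-- The initial endpoint. -/
def source {X : Type*} (H : CoarsePath X) : X := H.toFun ⟨0, le_refl 0, H.len_nonneg⟩

/-- The terminal endpoint. -/
def target {X : Type*} (H : CoarsePath X) : X := H.toFun ⟨H.len, H.len_nonneg, le_refl H.len⟩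

/-- The subset of `X` traced out by the path. -/
def image {X : Type*} (H : CoarsePath X) : Set X := Set.range H.toFun

/-- The path connects `x` and `y` (in one of the two directions). -/
def Connects {X : Type*} (H : CoarsePath X) (x y : X) : Prop :=
  (H.source = x ∧ H.target = y) ∨ (H.source = y ∧ H.target = x)

/-- The path is a `(K, C)`-quasi-geodesic: a `(K, C)`-quasi-isometric embedding of its interval. -/
def IsQuasiGeodesic {X : Type*} [MetricSpace X] (K C : ℝ) (H : CoarsePath X) : Prop :=
  ∀ s t : Set.Icc (0 : ℝ) H.len,
    (1 / K) * dist s t - C ≤ dist (H.toFun s) (H.toFun t) ∧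
      dist (H.toFun s) (H.toFun t) ≤ K * dist s t + C

end CoarsePath

/-- Every pair of points is connected by a path of the family. -/
def IsTransitiveFamily {X : Type*} (ℋ : Set (CoarsePath X)) : Prop :=
  ∀ x y : X, ∃ H ∈ ℋ, H.Connects x y

/-- `Φ : X → H` is a coarse projection onto the path `H` (it moves points of `H` by at most `c`; a
map which is the identity on `H` is a special case) which is contracting with constants `b, c`:
the ball of radius `b * dist μ (Φ μ)` about `μ` is sent within distance `c` of `Φ μ`. -/
def IsContractingProjection {X : Type*} [MetricSpace X] (b c : ℝ) (H : CoarsePath X)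
    (Φ : X → H.image) : Prop :=
  (∀ x : H.image, dist (Φ (x : X) : X) (x : X) ≤ c) ∧
    ∀ μ μ' : X, dist μ μ' < b * dist μ (Φ μ : X) → dist (Φ μ : X) (Φ μ' : X) < c

/-- The coarsely contracting property of a family of paths: it is transitive, and, with constants
`b, c > 0` uniform over the family, every path of the family admits a contracting projection. -/
def IsCoarselyContracting {X : Type*} [MetricSpace X] (ℋ : Set (CoarsePath X)) : Prop :=
  IsTransitiveFamily ℋ ∧
    ∃ b c : ℝ, 0 < b ∧ 0 < c ∧ ∀ H ∈ ℋ, ∃ Φ : X → H.image, IsContractingProjection b c H Φ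

/-! Let `τ` be the parameter of a point of `[x, y]` nearest to `z`. Following `[x, y]` up to that
point and then a geodesic to `z` gives a 1-Lipschitz path with quasi-geodesic constant 3
(`dist_concat_of_nearest`). Its ends are also joined by some `H ∈ ℋ`, and contraction makes such
paths stay near `H` (`IsContractingMap.infDist_le`): far from `H` the projection shrinks length by a
factor 6, so a long excursion would have ends too close together. The side `[x, z]` is near `H` for
the same reason, and conversely `H` is near `[x, z]` by connectedness
(`CoarsePath.IsQuasiGeodesic.dist_geodesic_le`). Hence the half of `[x, y]` from `x` is near `[x,
z]`; by symmetry the other half is near `[y, z]`. -/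

/-- The image of a path of a family with the contracting property, abstracted to a set `A` with a
map `Φ` to `A`: points of `A` move by at most `c`, and `Φ` contracts balls far from `A`. -/
def IsContractingMap {X : Type*} [MetricSpace X] (b c : ℝ) (A : Set X) (Φ : X → X) : Prop :=
  (∀ x, Φ x ∈ A) ∧ (∀ x ∈ A, dist (Φ x) x ≤ c) ∧
    ∀ μ μ' : X, dist μ μ' < b * dist μ (Φ μ) → dist (Φ μ) (Φ μ') < c

theorem IsContractingProjection.isContractingMap {X : Type*} [MetricSpace X] {b c : ℝ}
    {H : CoarsePath X} {Φ : X → H.image} (h : IsContractingProjection b c H Φ) :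
    IsContractingMap b c H.image (fun x => (Φ x : X)) :=
  ⟨fun x => (Φ x).2, fun x hx => h.1 ⟨x, hx⟩, h.2⟩

namespace IsContractingMap

variable {X : Type*} [MetricSpace X] {b c : ℝ} {A : Set X} {Φ : X → X}

/-- For `q ∈ A` almost nearest to `x`, either `q` lies in the contracted ball about `x`, so that `Φ
x`, `Φ q` and `q` are close, or the radius `b * dist x (Φ x)` of that ball is itself at most `D +
1`. -/
theorem dist_le_of_infDist_le (h : IsContractingMap b c A Φ) (hb : 0 < b) (hc : 0 < c) {D : ℝ}
    (hD : 0 < D) {x : X} (hx : Metric.infDist x A ≤ D) :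
    dist x (Φ x) ≤ (D + 1) + 2 * c + (D + 1) / b := by
  obtain ⟨q, hq, hxq⟩ := (Metric.infDist_lt_iff ⟨Φ x, h.1 x⟩).1 (hx.trans_lt (lt_add_one D))
  have hpos : 0 < (D + 1) / b := by positivity
  by_cases hlt : dist x q < b * dist x (Φ x)
  · have h1 := h.2.2 _ _ hlt
    have h2 := h.2.1 q hq
    have h3 := dist_triangle4_right x (Φ x) q (Φ q)
    rw [dist_comm q] at h3
    linarith
  · have : dist x (Φ x) ≤ (D + 1) / b := by
      rw [le_div_iff₀ hb]
      linarith [not_lt.1 hlt, mul_comm b (dist x (Φ x))]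
    linarith

/-- Far from `A`, a projected path moves at most `c` per step of length `r`. -/
theorem dist_proj_le_of_steps (h : IsContractingMap b c A Φ) {β : ℝ → X} {s₁ s₂ r : ℝ}
    (hr : 0 ≤ r) (hlip : ∀ s ∈ Set.Icc s₁ s₂, ∀ t ∈ Set.Icc s₁ s₂, dist (β s) (β t) ≤ |s - t|)
    (hfar : ∀ s ∈ Set.Icc s₁ s₂, r < b * dist (β s) (Φ (β s))) (n : ℕ) :
    ∀ t ∈ Set.Icc s₁ s₂, t - s₁ ≤ n * r → dist (Φ (β s₁)) (Φ (β t)) ≤ n * c := by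
  induction n with
  | zero =>
    intro t ht htn
    have : t = s₁ := le_antisymm (by simpa using htn) ht.1
    simp [this]
  | succ n ih =>
    intro t ht htn
    push_cast at htn ⊢
    have hu : max s₁ (t - r) ∈ Set.Icc s₁ s₂ :=
      ⟨le_max_left _ _, max_le (ht.1.trans ht.2) (by linarith [ht.2])⟩
    have h1 := ih _ hu (by
      rcases max_cases s₁ (t - r) with ⟨e, -⟩ | ⟨e, -⟩ <;> rw [e]
      · rw [sub_self]; positivity
      · linarith)
    have h2 : dist (β (max s₁ (t - r))) (β t) ≤ r := by
      refine (hlip _ hu _ ht).trans (abs_le.2 ⟨?_, ?_⟩)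
      · linarith [le_max_right s₁ (t - r)]
      · linarith [max_le ht.1 (by linarith : t - r ≤ t)]
    have h3 := h.2.2 _ _ (h2.trans_lt (hfar _ hu))
    linarith [dist_triangle (Φ (β s₁)) (Φ (β (max s₁ (t - r)))) (Φ (β t))]

/-- A bound for the length of an excursion out of the `12 * c / b`-neighborhood. -/
theorem excursion_length_le (h : IsContractingMap b c A Φ) (hb : 0 < b) (hc : 0 < c)
    {β : ℝ → X} {s₁ s₂ : ℝ} (hs : s₁ ≤ s₂)
    (hlip : ∀ s ∈ Set.Icc s₁ s₂, ∀ t ∈ Set.Icc s₁ s₂, dist (β s) (β t) ≤ |s - t|)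
    (hqg : s₂ - s₁ ≤ 3 * dist (β s₁) (β s₂))
    (hfar : ∀ s ∈ Set.Icc s₁ s₂, 12 * c / b ≤ Metric.infDist (β s) A)
    (h₁ : Metric.infDist (β s₁) A ≤ 12 * c / b) (h₂ : Metric.infDist (β s₂) A ≤ 12 * c / b) :
    s₂ - s₁ ≤ 12 * ((12 * c / b + 1) + 2 * c + (12 * c / b + 1) / b) + 6 * c := by
  have hD : 0 < 12 * c / b := by positivity
  have e₁ := h.dist_le_of_infDist_le hb hc hD h₁
  have e₂ := h.dist_le_of_infDist_le hb hc hD h₂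
  -- Contraction allows steps of length `6 * c`, each moving the projection by at most `c`. If `E`
  -- bounds the distance from either end to its projection, the length `L` satisfies `L ≤ 3 * (2 * E
  -- + L / 6 + c)`, hence `L ≤ 12 * E + 6 * c`.
  have hstep := h.dist_proj_le_of_steps (β := β) (r := 6 * c) (by positivity) hlip (fun s hs' => by
    have h1 : 12 * c / b ≤ dist (β s) (Φ (β s)) :=
      (hfar s hs').trans (Metric.infDist_le_dist_of_mem (h.1 _))
    rw [div_le_iff₀ hb] at h1
    linarith) ⌈(s₂ - s₁) / (6 * c)⌉₊ s₂ ⟨hs, le_rfl⟩ (by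
      rw [← div_le_iff₀ (by positivity)]
      exact Nat.le_ceil _)
  have hceil : (⌈(s₂ - s₁) / (6 * c)⌉₊ : ℝ) * c ≤ (s₂ - s₁) / 6 + c := by
    have h1 := (Nat.ceil_lt_add_one (a := (s₂ - s₁) / (6 * c))
      (div_nonneg (sub_nonneg.2 hs) (by positivity))).le
    calc _ ≤ ((s₂ - s₁) / (6 * c) + 1) * c := by gcongr
      _ = _ := by field_simp
  have h4 := dist_triangle4 (β s₁) (Φ (β s₁)) (Φ (β s₂)) (β s₂)
  rw [dist_comm (Φ (β s₂)) (β s₂)] at h4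
  linarith

/-- The Morse property of sets with a contracting map: a Lipschitz quasi-geodesic with endpoints
in `A` stays close to `A`. -/
theorem infDist_le (h : IsContractingMap b c A Φ) (hb : 0 < b) (hc : 0 < c)
    {β : ℝ → X} {T : ℝ}
    (hlip : ∀ s ∈ Set.Icc 0 T, ∀ t ∈ Set.Icc 0 T, dist (β s) (β t) ≤ |s - t|)
    (hqg : ∀ s ∈ Set.Icc 0 T, ∀ t ∈ Set.Icc 0 T, |s - t| ≤ 3 * dist (β s) (β t))
    (h0 : β 0 ∈ A) (hT : β T ∈ A) {t : ℝ} (ht : t ∈ Set.Icc 0 T) :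
    Metric.infDist (β t) A ≤
      12 * c / b + (12 * ((12 * c / b + 1) + 2 * c + (12 * c / b + 1) / b) + 6 * c) := by
  have hD : 0 < 12 * c / b := by positivity
  rcases le_or_gt (Metric.infDist (β t) A) (12 * c / b) with hle | hgt
  · exact hle.trans (le_add_of_nonneg_right (by positivity))
  have hcont : ContinuousOn (fun s => Metric.infDist (β s) A) (Set.Icc 0 T) := by
    refine (Metric.continuous_infDist_pt A).comp_continuousOn ?_
    exact (LipschitzOnWith.of_dist_le_mul (K := 1) fun s hs u hu => by
      simpa [Real.dist_eq] using hlip s hs u hu).continuousOn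
  have hcl : ∀ u v, 0 ≤ u → v ≤ T →
      IsCompact {s ∈ Set.Icc u v | Metric.infDist (β s) A ≤ 12 * c / b} := fun u v hu hv =>
    isCompact_Icc.of_isClosed_subset
      ((hcont.mono (Set.Icc_subset_Icc hu hv)).preimage_isClosed_of_isClosed isClosed_Icc
        isClosed_Iic) (fun s hs => hs.1)
  -- The excursion around `t` runs from the last visit `s₁` to the neighborhood before `t` to the
  -- first visit `s₂` after it.
  obtain ⟨s₁, ⟨hs₁, hs₁D⟩, hmax⟩ := (hcl 0 t le_rfl ht.2).exists_isGreatest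
    ⟨0, ⟨le_rfl, ht.1⟩, by rw [Metric.infDist_zero_of_mem h0]; exact hD.le⟩
  obtain ⟨s₂, ⟨hs₂, hs₂D⟩, hmin⟩ := (hcl t T ht.1 le_rfl).exists_isLeast
    ⟨T, ⟨ht.2, le_rfl⟩, by rw [Metric.infDist_zero_of_mem hT]; exact hD.le⟩
  have hsub : Set.Icc s₁ s₂ ⊆ Set.Icc 0 T := Set.Icc_subset_Icc hs₁.1 hs₂.2
  have hs12 : s₁ ≤ s₂ := hs₁.2.trans hs₂.1
  have hm₁ : s₁ ∈ Set.Icc 0 T := hsub ⟨le_rfl, hs12⟩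
  have hm₂ : s₂ ∈ Set.Icc 0 T := hsub ⟨hs12, le_rfl⟩
  -- the excursion is open at its ends, so the lower bound there comes from the closure
  have hopen : ∀ s ∈ Set.Ioo s₁ s₂, 12 * c / b ≤ Metric.infDist (β s) A := by
    intro s hs
    by_contra! hlt
    rcases le_total s t with hst | hst
    · exact hs.1.not_ge (hmax ⟨⟨hs₁.1.trans hs.1.le, hst⟩, hlt.le⟩)
    · exact hs.2.not_ge (hmin ⟨⟨hst, hs.2.le.trans hs₂.2⟩, hlt.le⟩)
  have hne : s₁ < s₂ := by
    refine lt_of_le_of_ne hs12 fun e => ?_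
    have : t = s₁ := le_antisymm (e ▸ hs₂.1) hs₁.2
    rw [this] at hgt
    exact hgt.not_ge hs₁D
  have hfar : ∀ s ∈ Set.Icc s₁ s₂, 12 * c / b ≤ Metric.infDist (β s) A := by
    have hcl' : IsClosed {s ∈ Set.Icc s₁ s₂ | 12 * c / b ≤ Metric.infDist (β s) A} :=
      (hcont.mono hsub).preimage_isClosed_of_isClosed isClosed_Icc isClosed_Ici
    have hIoo : Set.Ioo s₁ s₂ ⊆ {s ∈ Set.Icc s₁ s₂ | 12 * c / b ≤ Metric.infDist (β s) A} :=
      fun s hs => ⟨Set.Ioo_subset_Icc_self hs, hopen s hs⟩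
    have hcl2 := closure_minimal hIoo hcl'
    rw [closure_Ioo hne.ne] at hcl2
    exact fun s hs => (hcl2 hs).2
  have hlen := h.excursion_length_le hb hc hs12
    (fun s hs u hu => hlip s (hsub hs) u (hsub hu))
    (by
      have := hqg _ hm₁ _ hm₂
      rw [abs_sub_comm, abs_of_nonneg (sub_nonneg.2 hs12)] at this
      exact this) hfar hs₁D hs₂D
  have h5 := Metric.infDist_le_infDist_add_dist (s := A) (x := β t) (y := β s₁)
  have h6 := hlip _ ht _ hm₁
  rw [abs_of_nonneg (sub_nonneg.2 hs₁.2)] at h6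
  linarith [hs₂.1]

end IsContractingMap

section Geodesics

variable {X : Type*} [MetricSpace X]

/-- A quasi-geodesic is close to a geodesic with the same endpoints that is close to it. -/
theorem CoarsePath.IsQuasiGeodesic.dist_geodesic_le {K C R : ℝ} (hK : 1 ≤ K)
    {H : CoarsePath X} (hH : H.IsQuasiGeodesic K C) {x y : X} (hxy : H.Connects x y) {S : Set X}
    (hS : IsGeodesicSegment S x y) (hR : 0 < R) (hSH : ∀ p ∈ S, ∃ q ∈ H.image, dist p q < R) :
    ∀ q ∈ H.image, ∃ p ∈ S, dist q p ≤ K * (K * (2 * R + C)) + C + R := by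
  rintro _ ⟨t, rfl⟩
  obtain ⟨σ, hσ0, hσ1, hσ, rfl⟩ := hS
  have hpre : IsPreconnected (σ '' Set.Icc 0 (dist x y)) := by
    refine isPreconnected_Icc.image _ ?_
    exact (LipschitzOnWith.of_dist_le_mul (K := 1) fun s hs u hu => by
      simpa [Real.dist_eq] using (hσ s hs u hu).le).continuousOn
  have hx : x ∈ σ '' Set.Icc 0 (dist x y) := ⟨0, ⟨le_rfl, dist_nonneg⟩, hσ0⟩
  have hy : y ∈ σ '' Set.Icc 0 (dist x y) := ⟨_, ⟨dist_nonneg, le_rfl⟩, hσ1⟩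
  have hopen : ∀ I : Set (Set.Icc (0 : ℝ) H.len), IsOpen {p | ∃ s ∈ I, dist p (H.toFun s) < R} := by
    intro I
    have : {p | ∃ s ∈ I, dist p (H.toFun s) < R} = ⋃ s ∈ I, Metric.ball (H.toFun s) R := by
      ext p; simp
    rw [this]
    exact isOpen_biUnion fun s _ => Metric.isOpen_ball
  have hsrc : H.source ∈ {p | ∃ s ∈ Set.Iic t, dist p (H.toFun s) < R} :=
    ⟨⟨0, le_refl 0, H.len_nonneg⟩, t.2.1, by simpa [CoarsePath.source] using hR⟩
  have htgt : H.target ∈ {p | ∃ s ∈ Set.Ici t, dist p (H.toFun s) < R} :=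
    ⟨⟨H.len, H.len_nonneg, le_refl H.len⟩, t.2.2, by simpa [CoarsePath.target] using hR⟩
  have hends : H.source ∈ σ '' Set.Icc 0 (dist x y) ∧ H.target ∈ σ '' Set.Icc 0 (dist x y) := by
    rcases hxy with ⟨h1, h2⟩ | ⟨h1, h2⟩ <;> rw [h1, h2] <;> exact ⟨by assumption, by assumption⟩
  -- The points near `H` before time `t` and those near `H` after it form two open sets covering the
  -- connected geodesic, so some `p` is near both parts. The two parameters found are then close,
  -- and `t` lies between them.
  obtain ⟨p, hp, ⟨s₁, hs₁, hd₁⟩, ⟨s₂, hs₂, hd₂⟩⟩ := hpre _ _ (hopen (Set.Iic t))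
    (hopen (Set.Ici t)) (fun p hp => by
      obtain ⟨_, ⟨s, rfl⟩, hd⟩ := hSH p hp
      rcases le_total s t with hst | hst
      · exact Or.inl ⟨s, hst, hd⟩
      · exact Or.inr ⟨s, hst, hd⟩) ⟨_, hends.1, hsrc⟩ ⟨_, hends.2, htgt⟩
  have hK0 : 0 < K := by linarith
  have h1 : dist s₁ s₂ ≤ K * (2 * R + C) := by
    have h2 := (hH s₁ s₂).1
    have h3 := dist_triangle_left (H.toFun s₁) (H.toFun s₂) p
    have h4 : 1 / K * dist s₁ s₂ ≤ 2 * R + C := by linarith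
    rwa [one_div, inv_mul_le_iff₀ hK0] at h4
  have h2 : dist t s₁ ≤ K * (2 * R + C) := by
    refine le_trans ?_ h1
    have e1 : (s₁ : ℝ) ≤ t := hs₁
    have e2 : (t : ℝ) ≤ s₂ := hs₂
    rw [Subtype.dist_eq, Subtype.dist_eq, Real.dist_eq, Real.dist_eq, abs_of_nonneg (by linarith),
      abs_sub_comm, abs_of_nonneg (by linarith)]
    linarith
  refine ⟨p, hp, ?_⟩
  have h3 := (hH t s₁).2
  have h4 : K * dist t s₁ ≤ K * (K * (2 * R + C)) := by gcongr
  have h5 := dist_triangle_right (H.toFun t) p (H.toFun s₁)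
  linarith

/-- The concatenation of a geodesic `γ` on `[0, τ]` and a geodesic `η` on `[0, d]` to a point
whose nearest point on `γ` is `γ τ`. -/
theorem dist_concat_of_nearest {γ η : ℝ → X} {τ d : ℝ}
    (hγ : ∀ s ∈ Set.Icc 0 τ, ∀ t ∈ Set.Icc 0 τ, dist (γ s) (γ t) = |s - t|)
    (hη : ∀ s ∈ Set.Icc 0 d, ∀ t ∈ Set.Icc 0 d, dist (η s) (η t) = |s - t|)
    (hη0 : η 0 = γ τ) (hnear : ∀ s ∈ Set.Icc 0 τ, d ≤ dist (η d) (γ s)) {s t : ℝ}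
    (hs : s ∈ Set.Icc 0 τ) (ht : t ∈ Set.Icc 0 d) :
    dist (γ s) (η t) ≤ τ - s + t ∧ τ - s + t ≤ 3 * dist (γ s) (η t) := by
  have hτ : τ ∈ Set.Icc 0 τ := ⟨hs.1.trans hs.2, le_rfl⟩
  have h0 : (0 : ℝ) ∈ Set.Icc 0 d := ⟨le_rfl, ht.1.trans ht.2⟩
  have hd : d ∈ Set.Icc 0 d := ⟨ht.1.trans ht.2, le_rfl⟩
  have e1 := hγ s hs τ hτ
  rw [abs_sub_comm, abs_of_nonneg (sub_nonneg.2 hs.2), ← hη0] at e1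
  have e2 := hη 0 h0 t ht
  rw [abs_sub_comm, sub_zero, abs_of_nonneg ht.1] at e2
  have e3 := hη d hd t ht
  rw [abs_of_nonneg (sub_nonneg.2 ht.2)] at e3
  have e4 := hnear s hs
  have t1 := dist_triangle (γ s) (η 0) (η t)
  have t2 := dist_triangle (η d) (η t) (γ s)
  have t3 := dist_triangle_right (γ s) (η 0) (η t)
  rw [dist_comm (η t) (γ s)] at t2
  -- With `a = dist (γ s) (η t)`, nearness gives `t ≤ a`, so `τ - s ≤ a + t ≤ 2 * a`; the sum is at
  -- most `3 * a`.
  constructor <;> linarith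

/-- A geodesic `γ` is close to a set `A` with a contracting map if `A` contains the start of `γ`
and a point whose nearest point on `γ` is the end of `γ`. -/
theorem IsContractingMap.infDist_geodesic_le {b c : ℝ} {A : Set X} {Φ : X → X}
    (h : IsContractingMap b c A Φ) (hb : 0 < b) (hc : 0 < c) (hX : IsGeodesicSpace X)
    {γ : ℝ → X} {τ : ℝ} {z : X}
    (hγ : ∀ s ∈ Set.Icc 0 τ, ∀ t ∈ Set.Icc 0 τ, dist (γ s) (γ t) = |s - t|)
    (hnear : ∀ s ∈ Set.Icc 0 τ, dist z (γ τ) ≤ dist z (γ s)) (h0 : γ 0 ∈ A) (hz : z ∈ A)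
    {s : ℝ} (hs : s ∈ Set.Icc 0 τ) :
    Metric.infDist (γ s) A ≤
      12 * c / b + (12 * ((12 * c / b + 1) + 2 * c + (12 * c / b + 1) / b) + 6 * c) := by
  obtain ⟨_, η, hη0, hη1, hη, -⟩ := hX (γ τ) z
  set d := dist (γ τ) z with hd
  have hτ : 0 ≤ τ := hs.1.trans hs.2
  have hd0 : 0 ≤ d := dist_nonneg
  have hnear' : ∀ s ∈ Set.Icc 0 τ, d ≤ dist (η d) (γ s) := fun s hs => by
    rw [hη1, hd, dist_comm]; exact hnear s hs
  have key : ∀ s ∈ Set.Icc 0 τ, ∀ t ∈ Set.Icc 0 d,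
      dist (γ s) (η t) ≤ τ - s + t ∧ τ - s + t ≤ 3 * dist (γ s) (η t) :=
    fun s hs t ht => dist_concat_of_nearest hγ hη hη0 hnear' hs ht
  set β : ℝ → X := fun s => if s ≤ τ then γ s else η (s - τ) with hβ
  have hβ1 : ∀ s, s ≤ τ → β s = γ s := fun s hs => if_pos hs
  have hβ2 : ∀ s, τ < s → β s = η (s - τ) := fun s hs => if_neg hs.not_ge
  have hboth : ∀ s ∈ Set.Icc 0 (τ + d), ∀ t ∈ Set.Icc 0 (τ + d), s ≤ t →
      dist (β s) (β t) ≤ |s - t| ∧ |s - t| ≤ 3 * dist (β s) (β t) := by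
    intro s hs t ht hst
    rcases le_or_gt t τ with h1 | h1
    · rw [hβ1 s (hst.trans h1), hβ1 t h1, hγ s ⟨hs.1, hst.trans h1⟩ t ⟨ht.1, h1⟩]
      exact ⟨le_rfl, by linarith [abs_nonneg (s - t)]⟩
    · have ht' : t - τ ∈ Set.Icc 0 d := ⟨by linarith, by linarith [ht.2]⟩
      rcases le_or_gt s τ with h2 | h2
      · rw [hβ1 s h2, hβ2 t h1, abs_sub_comm, abs_of_nonneg (sub_nonneg.2 hst),
          show t - s = τ - s + (t - τ) by ring]
        exact key s ⟨hs.1, h2⟩ _ ht'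
      · rw [hβ2 s h2, hβ2 t h1, hη _ ⟨by linarith, by linarith [hs.2]⟩ _ ht',
          sub_sub_sub_cancel_right]
        exact ⟨le_rfl, by linarith [abs_nonneg (s - t)]⟩
  have hsym : ∀ s ∈ Set.Icc 0 (τ + d), ∀ t ∈ Set.Icc 0 (τ + d),
      dist (β s) (β t) ≤ |s - t| ∧ |s - t| ≤ 3 * dist (β s) (β t) := by
    intro s hs t ht
    rcases le_total s t with hst | hst
    · exact hboth s hs t ht hst
    · rw [dist_comm, abs_sub_comm]
      exact hboth t ht s hs hst
  have hend : β (τ + d) = z := by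
    rcases hd0.eq_or_lt with h1 | h1
    · rw [← h1, add_zero, hβ1 τ le_rfl]
      exact dist_eq_zero.1 (hd ▸ h1.symm)
    · rw [hβ2 _ (by linarith), add_sub_cancel_left, hη1]
  have := h.infDist_le hb hc (β := β) (T := τ + d) (fun s hs t ht => (hsym s hs t ht).1)
    (fun s hs t ht => (hsym s hs t ht).2) (by rwa [hβ1 0 hτ]) (by rwa [hend])
    (t := s) ⟨hs.1, by linarith [hs.2]⟩
  rwa [hβ1 s hs.2] at this

/-- In a space with a contracting family of quasi-geodesics, a geodesic `γ` is uniformly close to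
any geodesic from its start to a point whose nearest point on `γ` is the end of `γ`. -/
theorem exists_dist_le_of_nearest (hX : IsGeodesicSpace X)
    {K C : ℝ} (hK : 1 ≤ K) (hC : 0 ≤ C) {ℋ : Set (CoarsePath X)}
    (hquasi : ∀ H ∈ ℋ, H.IsQuasiGeodesic K C) (hcontr : IsCoarselyContracting ℋ) :
    ∃ δ : ℝ, 0 ≤ δ ∧ ∀ (γ : ℝ → X) (τ : ℝ) (z : X) (S : Set X),
      (∀ s ∈ Set.Icc 0 τ, ∀ t ∈ Set.Icc 0 τ, dist (γ s) (γ t) = |s - t|) →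
      (∀ s ∈ Set.Icc 0 τ, dist z (γ τ) ≤ dist z (γ s)) → IsGeodesicSegment S (γ 0) z →
      ∀ s ∈ Set.Icc 0 τ, ∃ q ∈ S, dist (γ s) q ≤ δ := by
  obtain ⟨htrans, b, c, hb, hc, hproj⟩ := hcontr
  set R : ℝ := 12 * c / b +
    (12 * ((12 * c / b + 1) + 2 * c + (12 * c / b + 1) / b) + 6 * c) with hRdef
  have hR : 0 < R := by positivity
  refine ⟨(R + 1) + (K * (K * (2 * (R + 1) + C)) + C + (R + 1)), by positivity,
    fun γ τ z S hγ hnear hS s hs => ?_⟩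
  obtain ⟨H, hH, hconn⟩ := htrans (γ 0) z
  obtain ⟨Φ, hΦ⟩ := hproj H hH
  have hmap := hΦ.isContractingMap
  have hmem : γ 0 ∈ H.image ∧ z ∈ H.image := by
    have h1 : H.source ∈ H.image := ⟨_, rfl⟩
    have h2 : H.target ∈ H.image := ⟨_, rfl⟩
    rcases hconn with ⟨e1, e2⟩ | ⟨e1, e2⟩ <;> rw [e1] at h1 <;> rw [e2] at h2
    exacts [⟨h1, h2⟩, ⟨h2, h1⟩]
  have hne : H.image.Nonempty := ⟨_, hmem.1⟩
  have hnearH : ∀ p ∈ S, ∃ q ∈ H.image, dist p q < R + 1 := by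
    obtain ⟨σ, hσ0, hσ1, hσ, rfl⟩ := hS
    rintro _ ⟨u, hu, rfl⟩
    refine (Metric.infDist_lt_iff hne).1 (lt_of_le_of_lt ?_ (lt_add_one R))
    -- Here the geodesic already ends at `z`, so the nearest-point condition is trivial.
    exact hmap.infDist_geodesic_le hb hc hX (z := z) hσ
      (fun v _ => by rw [hσ1, dist_self]; exact dist_nonneg) (by rw [hσ0]; exact hmem.1) hmem.2 hu
  obtain ⟨p, hp, hdp⟩ := (Metric.infDist_lt_iff hne).1 (lt_of_le_of_lt
    (hmap.infDist_geodesic_le hb hc hX hγ hnear hmem.1 hmem.2 hs) (lt_add_one R))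
  obtain ⟨q, hq, hdq⟩ :=
    (hquasi H hH).dist_geodesic_le hK hconn hS (by positivity) hnearH p hp
  exact ⟨q, hq, (dist_triangle _ p _).trans (add_le_add hdp.le hdq)⟩

end Geodesics

theorem theorem5p10 {X : Type*} [MetricSpace X] (hX : IsGeodesicSpace X)
    (K C : ℝ) (hK : 1 ≤ K) (hC : 0 ≤ C) (ℋ : Set (CoarsePath X))
    (hquasi : ∀ H ∈ ℋ, H.IsQuasiGeodesic K C) (hcontr : IsCoarselyContracting ℋ) :
    IsHyperbolicSpace X := by
  obtain ⟨δ, hδ, key⟩ := exists_dist_le_of_nearest hX hK hC hquasi hcontr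
  refine ⟨δ, hδ, ?_⟩
  rintro x y z _ yz xz ⟨γ, hγ0, hγ1, hγ, rfl⟩ hyz hxz _ ⟨s, hs, rfl⟩
  set d := dist x y with hd
  have hcont : ContinuousOn (fun t => dist z (γ t)) (Set.Icc 0 d) := by
    refine (continuous_const.dist continuous_id).comp_continuousOn ?_
    exact (LipschitzOnWith.of_dist_le_mul (K := 1) fun s hs u hu => by
      simpa [Real.dist_eq] using (hγ s hs u hu).le).continuousOn
  obtain ⟨τ, hτ, hmin⟩ := isCompact_Icc.exists_isMinOn ⟨s, hs⟩ hcont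
  rcases le_total s τ with hst | hst
  · have hsub : Set.Icc 0 τ ⊆ Set.Icc 0 d := Set.Icc_subset_Icc le_rfl hτ.2
    obtain ⟨q, hq, hdq⟩ := key γ τ z xz (fun u hu v hv => hγ u (hsub hu) v (hsub hv))
      (fun u hu => hmin (hsub hu)) (by rwa [hγ0]) s ⟨hs.1, hst⟩
    exact ⟨q, Or.inl hq, hdq⟩
  -- The remaining half is the same case for `[x, y]` traversed from `y`.
  · have hsub : ∀ u ∈ Set.Icc 0 (d - τ), d - u ∈ Set.Icc 0 d := fun u hu =>
      ⟨by linarith [hu.2, hτ.1], by linarith [hu.1]⟩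
    obtain ⟨q, hq, hdq⟩ := key (fun u => γ (d - u)) (d - τ) z yz
      (fun u hu v hv => by
        rw [hγ _ (hsub u hu) _ (hsub v hv), sub_sub_sub_cancel_left, abs_sub_comm])
      (fun u hu => by simpa using hmin (hsub u hu)) (by simpa [hγ1] using hyz) (d - s)
      ⟨by linarith [hs.2], by linarith⟩
    exact ⟨q, Or.inr hq, by simpa using hdq⟩
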